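/- **Theorem 1.5.** A configuration is a nonzero summable sequence $X=(X_i)_{i\ge 1}$ of nonnegative integers, $X_i$ being the number of particles of size $i$; put $\|X\|_1=\sum_{i\ge1} X_i$, let $\ell_X=\min\{i\ge 1 : X_i>0\}$ be the minimal size in $X$, and let $(\mathbf e_i)_{i\ge 1}$ denote the canonical basis. Let $\phi:\{1,2,3,\dots\}\to(0,\infty)$ be a positive non-decreasing function and put $K(i,j)=\phi(i)\wedge\phi(j)$ for $i,j\ge 1$. For a configuration $X_0$, let $(X(t))_{t\ge 0}$ be the min-driven coagulation process started from $X(0)=X_0$, that is, the continuous-time Markov chain which, from a state $X$ with minimal size $\ell=\ell_X$, jumps to - $X-\mathbf e_\ell-\mathbf e_j+\mathbf e_{\ell+j}$ at rate $K(\ell,j)\,X_j$, for each $j>\ell$, and - $X-2\mathbf e_\ell+\mathbf e_{2\ell}$ at rate $K(\ell,\ell)\,(X_\ell-1)$. Let $T^{X_0}=\inf\{t\ge 0 : \|X(t)\|_1=1\}$ be the time after which the process is reduced to a single particle. Then $$\sup_{X_0}\ \mathbb E\bigl(T^{X_0}\bigr)<\infty\qquad\text{if and only if}\qquad\sum_{i=1}^\infty\frac1{i\,\phi(i)}<\infty,$$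 where the supremum is taken over all (nonzero) configurations $X_0$. -/

import Mathlib

open MeasureTheory ProbabilityTheory
open scoped NNReal ENNReal

noncomputable section

namespace MinDriven

/-- A configuration of particles: `X i` is the number of particles of size `i ≥ 1`.
A summable sequence of nonnegative integers has only finitely many nonzero terms, so these are
exactly the nonnegative integer-valued elements of `ℓ¹`. -/
abbrev Config : Type := ℕ+ →₀ ℕ

instance : MeasurableSpace Config := ⊤

instance : DiscreteMeasurableSpace Config := ⟨fun _ => trivial⟩

/-- The number of particles `‖X‖₁ = ∑ i, X i`. -/
def numParticles (X : Config) : ℕ := X.sum fun _ m => m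

/-- The smallest size present in `X` (with the irrelevant value `1` for the empty configuration). -/
def minSize (X : Config) : ℕ+ :=
  if h : X.support.Nonempty then X.support.min' h else 1

/-- The configuration obtained from `X` by removing a particle of minimal size `ℓ` and another
particle of size `j`, and adding a particle of size `ℓ + j`. -/
def merge (X : Config) (j : ℕ+) : Config :=
  X - Finsupp.single (minSize X) 1 - Finsupp.single j 1 + Finsupp.single (minSize X + j) 1

/-- The number of particles of size `j` with which one given particle of minimal size `ℓ` can
merge: it is `X j` if `j ≠ ℓ` and `X ℓ - 1` if `j = ℓ`. -/
def numPartners (X : Config) (j : ℕ+) : ℕ :=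
  if j = minSize X then X j - 1 else X j

/-- The rate of the jump from `X` to `merge X j`, for the coagulation kernel `K`. -/
def rate (K : ℕ+ → ℕ+ → ℝ≥0) (X : Config) (j : ℕ+) : ℝ≥0 :=
  K (minSize X) j * numPartners X j

/-- The total jump rate `(∑_{j ≥ ℓ} K(ℓ, j) X_j) - K(ℓ, ℓ)`, `ℓ` being the minimal size of `X`. -/
def totalRate (K : ℕ+ → ℕ+ → ℝ≥0) (X : Config) : ℝ≥0∞ :=
  ∑' j : ℕ+, (rate K X j : ℝ≥0∞)

theorem totalRate_ne_top (K : ℕ+ → ℕ+ → ℝ≥0) (X : Config) : totalRate K X ≠ ∞ := by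
  have h : totalRate K X = ∑ j ∈ X.support, (rate K X j : ℝ≥0∞) := by
    refine tsum_eq_sum fun j hj => ?_
    have hj0 : X j = 0 := by simpa using hj
    simp [rate, numPartners, hj0]
  rw [h]
  exact ENNReal.sum_ne_top.2 fun j _ => ENNReal.coe_ne_top

open scoped Classical in
/-- The law of the state reached from `X` by the first jump: `merge X j` has probability
`rate K X j / totalRate K X`; a state with zero total rate is absorbing. -/
def jumpLaw (K : ℕ+ → ℕ+ → ℝ≥0) (X : Config) : PMF Config :=
  if h : totalRate K X = 0 then PMF.pure X
  else (PMF.normalize (fun j => (rate K X j : ℝ≥0∞)) h (totalRate_ne_top K X)).map (merge X)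

/-- The transition kernel of the embedded jump chain. -/
def jumpKernel (K : ℕ+ → ℕ+ → ℝ≥0) : Kernel Config Config :=
  Kernel.ofFunOfCountable fun X => (jumpLaw K X).toMeasure

instance (K : ℕ+ → ℕ+ → ℝ≥0) : IsMarkovKernel (jumpKernel K) :=
  ⟨fun X => inferInstanceAs (IsProbabilityMeasure (jumpLaw K X).toMeasure)⟩

/-- The law of the embedded jump chain started from `X₀`: the Markov chain with transition
kernel `jumpKernel K`. -/
def chainLaw (K : ℕ+ → ℕ+ → ℝ≥0) (X₀ : Config) : Measure (ℕ → Config) :=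
  Kernel.trajMeasure (X := fun _ => Config) (Measure.dirac X₀) fun n =>
    (jumpKernel K).comap
      (fun h : (i : Finset.Iic n) → Config => h ⟨n, Finset.mem_Iic.2 le_rfl⟩)
      (measurable_pi_apply _)

/-- The sample space: a path of the embedded jump chain, and a sequence of clocks. -/
abbrev Sample : Type := (ℕ → Config) × (ℕ → ℝ)

/-- The probability on the sample space: the embedded jump chain started from `X₀` and,
independently of it, an i.i.d. sequence of exponential clocks with parameter `1`. -/
def law (K : ℕ+ → ℕ+ → ℝ≥0) (X₀ : Config) : Measure Sample :=
  (chainLaw K X₀).prod (Measure.infinitePi fun _ : ℕ => expMeasure 1)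

instance (K : ℕ+ → ℕ+ → ℝ≥0) (X₀ : Config) : IsProbabilityMeasure (law K X₀) := by
  have : IsProbabilityMeasure (expMeasure 1) := isProbabilityMeasure_expMeasure one_pos
  unfold law chainLaw
  infer_instance

/-- The time of the `n`-th jump. The time spent in the `k`-th state of the jump chain is its
clock divided by the total rate in that state, an exponential time whose parameter is that
rate; it is infinite in an absorbing state. -/
def jumpTime (K : ℕ+ → ℕ+ → ℝ≥0) (n : ℕ) (ω : Sample) : ℝ≥0∞ :=
  ∑ k ∈ Finset.range n, ENNReal.ofReal (ω.2 k) / totalRate K (ω.1 k)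

/-- The min-driven coagulation process: under `law K X₀` it is the continuous-time Markov chain
started from `X₀` that jumps from `X` to `merge X j` at rate `rate K X j`. At time `t` it is in the
`n`-th state of the jump chain, `n` being the first index with `t < jumpTime (n + 1)`. -/
def process (K : ℕ+ → ℕ+ → ℝ≥0) (t : ℝ≥0) (ω : Sample) : Config :=
  ω.1 (sInf {n : ℕ | (t : ℝ≥0∞) < jumpTime K (n + 1) ω})

/-- The first time at which there is exactly one particle (`∞` if there is no such time). -/
def lastTime (K : ℕ+ → ℕ+ → ℝ≥0) (ω : Sample) : ℝ≥0∞ :=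
  ⨅ (t : ℝ≥0) (_ : numParticles (process K t ω) = 1), (t : ℝ≥0∞)

/-- The expectation, in `[0, ∞]`, of the time after which the process started from `X₀` is reduced
to a single particle. -/
def expectedLastTime (K : ℕ+ → ℕ+ → ℝ≥0) (X₀ : Config) : ℝ≥0∞ :=
  ∫⁻ ω, lastTime K ω ∂(law K X₀)

end MinDriven

end

/-!
Every kernel of the form `φ i ∧ φ j` with `φ` non-decreasing gives a minimal particle, of size `ℓ`
say, the same rate `φ ℓ` of merging with each of the other `n - 1` particles. The embedded jump chain
therefore does not depend on `φ`: each jump merges the minimal particle with a uniformly chosen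
other one. From `N` particles, the process is reduced to a single one after exactly `N - 1` jumps,
and the mean of the last time is the sum over these jumps of the mean of `1 / (φ ℓ * (n - 1))`
(`expectedLastTime_minKernel`). By Cauchy condensation, `∑ 1 / (i φ i)` converges if and only if
`∑ 1 / φ (2 ^ k)` does (`summable_iff_tsum_invDyadic_ne_top`).

*Upper bound.* While `2 ^ k ≤ ℓ < 2 ^ (k + 1)`, let `s` be the number of small particles, those of
size less than `2 ^ (k + 1)`. A merger produces a particle that is not small, so a jump removes two
small particles with probability `(s - 1) / (n - 1)`, and one otherwise. Consequently the mean of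
`s / (n - 1)` decreases at each jump by `1 / (n - 1)`, or more if the jump is the last one. As
`s / (n - 1) ≤ 2`, the mean time spent at the scale `k` is at most `2 / φ (2 ^ k)`, uniformly in the
starting configuration. The scales are put together in one Lyapunov function, `potential`, with the
drift inequality `lintegral_potential_add_le`.

*Lower bound.* From `2 ^ m` particles of size `1`, conservation of mass gives `ℓ * n ≤ 2 ^ m`
almost surely, hence the time during which `2 ^ p < n ≤ 2 ^ (p + 1)` has mean at least
`1 / (2 * φ (2 ^ (m - p)))`. Summing over `p` and letting `m` grow yields `∑ 1 / φ (2 ^ k)`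
(`sum_invDyadic_le`).
-/

namespace MinDriven

/-! ### The embedded jump chain -/

theorem lintegral_chainLaw_zero (K : ℕ+ → ℕ+ → ℝ≥0) (X₀ : Config) (f : Config → ℝ≥0∞) :
    ∫⁻ ω, f (ω 0) ∂(chainLaw K X₀) = f X₀ := by
  have hf : Measurable f := measurable_of_countable f
  have h0 : (chainLaw K X₀).map (Preorder.frestrictLe (π := fun _ : ℕ => Config) 0) =
      (Measure.dirac X₀).map
        (MeasurableEquiv.piUnique (fun _ : Finset.Iic 0 => Config)).symm := by
    unfold chainLaw Kernel.trajMeasure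
    rw [Measure.map_comp _ _ (by fun_prop), Kernel.traj_map_frestrictLe,
      Kernel.partialTraj_self, Measure.id_comp]
  have h1 : ∫⁻ ω, f (ω 0) ∂(chainLaw K X₀) =
      ∫⁻ h, f (h ⟨0, Finset.mem_Iic.2 le_rfl⟩)
        ∂((chainLaw K X₀).map (Preorder.frestrictLe (π := fun _ : ℕ => Config) 0)) := by
    rw [lintegral_map (by fun_prop) (by fun_prop)]
    rfl
  rw [h1, h0, lintegral_map (by fun_prop) (by fun_prop), lintegral_dirac]
  rfl

/-- The Markov property at time `n`, for functions of the next state. -/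
theorem lintegral_chainLaw_succ (K : ℕ+ → ℕ+ → ℝ≥0) (X₀ : Config) (n : ℕ)
    (f : Config → ℝ≥0∞) :
    ∫⁻ ω, f (ω (n + 1)) ∂(chainLaw K X₀) =
      ∫⁻ ω, ∫⁻ Y, f Y ∂(jumpKernel K (ω n)) ∂(chainLaw K X₀) := by
  have hf : Measurable f := measurable_of_countable f
  have hg : Measurable fun X => ∫⁻ Y, f Y ∂(jumpKernel K X) := measurable_of_countable _
  have key := Kernel.map_frestrictLe_trajMeasure_compProd_eq_map_trajMeasure
    (X := fun _ : ℕ => Config) (μ₀ := Measure.dirac X₀)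
    (κ := fun n => (jumpKernel K).comap
      (fun h : (i : Finset.Iic n) → Config => h ⟨n, Finset.mem_Iic.2 le_rfl⟩)
      (measurable_pi_apply _)) (a := n)
  have h2 := congrArg (fun μ => ∫⁻ p, f p.2 ∂μ) key
  rw [Measure.lintegral_compProd (by fun_prop), lintegral_map (by fun_prop) (by fun_prop),
    lintegral_map (by fun_prop) (by fun_prop)] at h2
  exact h2.symm

/-- A property that holds at the start and is passed on by every jump holds at all times. -/
theorem ae_chainLaw_of_jumpKernel (K : ℕ+ → ℕ+ → ℝ≥0) (X₀ : Config) (P : ℕ → Config → Prop)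
    (h0 : P 0 X₀) (hs : ∀ n X, P n X → ∀ᵐ Y ∂(jumpKernel K X), P (n + 1) Y) :
    ∀ᵐ ω ∂(chainLaw K X₀), ∀ n, P n (ω n) := by
  classical
  have hi : ∀ n (μ : Measure Config), ∫⁻ X, (if P n X then 0 else 1) ∂μ = 0 ↔ ∀ᵐ X ∂μ, P n X := by
    intro n μ
    rw [lintegral_eq_zero_iff (measurable_of_countable _)]
    refine Filter.eventually_congr (.of_forall fun X => ?_)
    by_cases h : P n X <;> simp [h]
  have hi' : ∀ n, ∫⁻ ω, (if P n (ω n) then 0 else 1) ∂(chainLaw K X₀) = 0 ↔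
      ∀ᵐ ω ∂(chainLaw K X₀), P n (ω n) := by
    intro n
    have hm : Measurable fun X => if P n X then (0 : ℝ≥0∞) else 1 := measurable_of_countable _
    have hm' : Measurable fun ω : ℕ → Config => if P n (ω n) then (0 : ℝ≥0∞) else 1 :=
      hm.comp (measurable_pi_apply n)
    rw [lintegral_eq_zero_iff hm']
    refine Filter.eventually_congr (.of_forall fun ω => ?_)
    by_cases h : P n (ω n) <;> simp [h]
  rw [ae_all_iff]
  intro n
  induction n with
  | zero => rw [← hi', lintegral_chainLaw_zero K X₀ fun X => if P 0 X then 0 else 1]; simp [h0]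
  | succ n ih =>
    rw [← hi', lintegral_chainLaw_succ K X₀ n fun X => if P (n + 1) X then 0 else 1]
    refine (lintegral_congr_ae ?_).trans lintegral_zero
    filter_upwards [ih] with ω hω using (hi _ _).2 (hs n _ hω)

theorem lintegral_jumpKernel (K : ℕ+ → ℕ+ → ℝ≥0) (X : Config) (h : totalRate K X ≠ 0)
    (f : Config → ℝ≥0∞) :
    ∫⁻ Y, f Y ∂(jumpKernel K X) = ∑' j, f (merge X j) * (rate K X j * (totalRate K X)⁻¹) := by
  let _ : MeasurableSpace ℕ+ := ⊤
  have : DiscreteMeasurableSpace ℕ+ := ⟨fun _ => trivial⟩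
  change ∫⁻ Y, f Y ∂(jumpLaw K X).toMeasure = _
  rw [jumpLaw, dif_neg h, ← PMF.toMeasure_map (f := merge X) _ (measurable_of_countable _),
    lintegral_map (measurable_of_countable _) (measurable_of_countable _), lintegral_countable']
  refine tsum_congr fun j => ?_
  rw [PMF.toMeasure_apply_singleton _ _ (measurableSet_singleton _)]
  rfl

theorem ae_jumpKernel (K : ℕ+ → ℕ+ → ℝ≥0) (X : Config) (h : totalRate K X ≠ 0)
    {P : Config → Prop} (hP : ∀ j, rate K X j ≠ 0 → P (merge X j)) :
    ∀ᵐ Y ∂(jumpKernel K X), P Y := by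
  classical
  have : ∫⁻ Y, (if P Y then 0 else 1) ∂(jumpKernel K X) = 0 := by
    rw [lintegral_jumpKernel K X h]
    refine ENNReal.tsum_eq_zero.2 fun j => ?_
    by_cases hj : rate K X j = 0
    · simp [hj]
    · simp [hP j hj]
  rw [lintegral_eq_zero_iff (measurable_of_countable _)] at this
  filter_upwards [this] with Y hY
  by_contra hn
  simp [hn] at hY

theorem ae_jumpKernel_of_totalRate_eq_zero (K : ℕ+ → ℕ+ → ℝ≥0) (X : Config)
    (h : totalRate K X = 0) {P : Config → Prop} (hP : P X) :
    ∀ᵐ Y ∂(jumpKernel K X), P Y := by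
  change ∀ᵐ Y ∂(jumpLaw K X).toMeasure, P Y
  rw [jumpLaw, dif_pos h, PMF.toMeasure_pure]
  simpa using hP

/-! ### The clocks -/

theorem lintegral_ofReal_expMeasure_one : ∫⁻ x, ENNReal.ofReal x ∂(expMeasure 1) = 1 := by
  unfold expMeasure gammaMeasure
  have hm : Measurable (gammaPDF 1 1) := (measurable_gammaPDFReal 1 1).ennreal_ofReal
  rw [lintegral_withDensity_eq_lintegral_mul _ hm ENNReal.measurable_ofReal]
  have h1 : ∀ x : ℝ, (gammaPDF 1 1 * fun x => ENNReal.ofReal x) x =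
      (Set.Ioi (0 : ℝ)).indicator (fun x => ENNReal.ofReal (Real.exp (-x) * x ^ ((2 : ℝ) - 1))) x := by
    intro x
    rcases le_or_gt x 0 with hx | hx
    · simp [hx, ENNReal.ofReal_of_nonpos hx]
    · rw [Set.indicator_of_mem (Set.mem_Ioi.2 hx), Pi.mul_apply, gammaPDF_of_nonneg hx.le,
        ← ENNReal.ofReal_mul (by positivity)]
      norm_num
  rw [lintegral_congr h1, lintegral_indicator measurableSet_Ioi,
    ← ofReal_integral_eq_lintegral_ofReal (Real.GammaIntegral_convergent two_pos),
    ← Real.Gamma_eq_integral two_pos, Real.Gamma_two, ENNReal.ofReal_one]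
  filter_upwards [ae_restrict_mem measurableSet_Ioi] with x hx
  have : (0 : ℝ) < x := hx
  positivity

theorem ae_pos_expMeasure_one : ∀ᵐ x ∂(expMeasure 1), 0 < x := by
  unfold expMeasure gammaMeasure
  have hm : Measurable (gammaPDF 1 1) := (measurable_gammaPDFReal 1 1).ennreal_ofReal
  rw [ae_withDensity_iff hm]
  have h0 : ∀ᵐ x : ℝ, x ≠ 0 := by simp [ae_iff]
  filter_upwards [h0] with x hx h
  by_contra hn
  exact h (gammaPDF_of_neg (lt_of_le_of_ne (not_lt.1 hn) hx))

theorem ae_clock_pos (K : ℕ+ → ℕ+ → ℝ≥0) (X₀ : Config) :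
    ∀ᵐ ω ∂(law K X₀), ∀ n, 0 < ω.2 n := by
  have : IsProbabilityMeasure (expMeasure 1) := isProbabilityMeasure_expMeasure one_pos
  rw [ae_all_iff]
  intro n
  have h1 : ∀ᵐ c ∂(Measure.infinitePi fun _ : ℕ => expMeasure 1), 0 < c n :=
    (measurePreserving_eval_infinitePi (fun _ : ℕ => expMeasure 1) n).quasiMeasurePreserving.ae
      ae_pos_expMeasure_one
  exact Measure.quasiMeasurePreserving_snd.ae h1

theorem ae_law_of_ae_chainLaw (K : ℕ+ → ℕ+ → ℝ≥0) (X₀ : Config) {P : (ℕ → Config) → Prop}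
    (h : ∀ᵐ y ∂(chainLaw K X₀), P y) : ∀ᵐ ω ∂(law K X₀), P ω.1 :=
  have : IsProbabilityMeasure (expMeasure 1) := isProbabilityMeasure_expMeasure one_pos
  Measure.quasiMeasurePreserving_fst.ae h

/-- The mean sojourn time in a state is the inverse of its total rate, as clocks have mean `1`
and are independent of the jump chain. -/
theorem lintegral_jumpTime (K : ℕ+ → ℕ+ → ℝ≥0) (X₀ : Config) (n : ℕ) :
    ∫⁻ ω, jumpTime K n ω ∂(law K X₀) =
      ∑ k ∈ Finset.range n, ∫⁻ y, (totalRate K (y k))⁻¹ ∂(chainLaw K X₀) := by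
  have : IsProbabilityMeasure (expMeasure 1) := isProbabilityMeasure_expMeasure one_pos
  have hr : Measurable fun X => (totalRate K X)⁻¹ := measurable_of_countable _
  have hr' : ∀ k : ℕ, Measurable fun y : ℕ → Config => (totalRate K (y k))⁻¹ :=
    fun k => hr.comp (measurable_pi_apply k)
  have hc : ∀ k : ℕ, Measurable fun c : ℕ → ℝ => ENNReal.ofReal (c k) :=
    fun k => ENNReal.measurable_ofReal.comp (measurable_pi_apply k)
  unfold jumpTime
  simp_rw [div_eq_mul_inv, mul_comm (ENNReal.ofReal _)]
  have hm : ∀ k : ℕ, Measurable fun ω : Sample =>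
      (totalRate K (ω.1 k))⁻¹ * ENNReal.ofReal (ω.2 k) := fun k =>
    ((hr' k).comp measurable_fst).mul ((hc k).comp measurable_snd)
  rw [lintegral_finsetSum _ fun k _ => hm k]
  refine Finset.sum_congr rfl fun k _ => ?_
  unfold law
  rw [lintegral_prod_mul (f := fun y : ℕ → Config => (totalRate K (y k))⁻¹)
    (g := fun c : ℕ → ℝ => ENNReal.ofReal (c k)) (hr' k).aemeasurable (hc k).aemeasurable,
    (measurePreserving_eval_infinitePi (fun _ : ℕ => expMeasure 1) k).lintegral_comp
      ENNReal.measurable_ofReal, lintegral_ofReal_expMeasure_one, mul_one]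

/-- If all clocks are positive and the path leaves its first `n` states, which have more than one
particle, to be absorbed in the `n`-th one, which has a single particle, then the last time is the
time of the `n`-th jump. -/
theorem lastTime_eq_jumpTime (K : ℕ+ → ℕ+ → ℝ≥0) (ω : Sample) (n : ℕ) (hω : ∀ k, 0 < ω.2 k)
    (hlt : ∀ k < n, totalRate K (ω.1 k) ≠ 0 ∧ numParticles (ω.1 k) ≠ 1)
    (hn : totalRate K (ω.1 n) = 0) (hn1 : numParticles (ω.1 n) = 1) :
    lastTime K ω = jumpTime K n ω := by
  have hmono : Monotone fun m => jumpTime K m ω := fun a b hab =>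
    Finset.sum_le_sum_of_subset (Finset.range_mono hab)
  have hfin : jumpTime K n ω ≠ ∞ := by
    refine ENNReal.sum_ne_top.2 fun k hk => ?_
    exact ENNReal.div_ne_top ENNReal.ofReal_ne_top (hlt k (Finset.mem_range.1 hk)).1
  have htop : jumpTime K (n + 1) ω = ∞ := by
    rw [jumpTime, Finset.sum_range_succ, hn, ENNReal.div_zero, add_top]
    simpa using hω n
  refine le_antisymm ?_ ?_
  · have hproc : numParticles (process K (jumpTime K n ω).toNNReal ω) = 1 := by
      have : sInf {m : ℕ | (((jumpTime K n ω).toNNReal : ℝ≥0) : ℝ≥0∞) < jumpTime K (m + 1) ω}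
          = n := by
        rw [ENNReal.coe_toNNReal hfin]
        refine IsLeast.csInf_eq ⟨?_, fun m hm => ?_⟩
        · change jumpTime K n ω < jumpTime K (n + 1) ω
          rw [htop]
          exact hfin.lt_top
        · by_contra hmn
          exact absurd (hmono (show m + 1 ≤ n by omega)) (not_le.2 hm)
      rw [process, this, hn1]
    calc lastTime K ω ≤ ((jumpTime K n ω).toNNReal : ℝ≥0∞) :=
          iInf₂_le (f := fun (t : ℝ≥0) (_ : numParticles (process K t ω) = 1) => (t : ℝ≥0∞))
            _ hproc
      _ = jumpTime K n ω := ENNReal.coe_toNNReal hfin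
  · refine le_iInf₂ fun t ht => ?_
    by_contra! hlt'
    rcases n with _ | m
    · simp [jumpTime] at hlt'
    · have : sInf {i : ℕ | (t : ℝ≥0∞) < jumpTime K (i + 1) ω} ≤ m := Nat.sInf_le hlt'
      exact (hlt _ (Nat.lt_succ_of_le this)).2 ht

/-! ### Additive functionals of configurations -/

/-- The sum `∑ i, X i * g i` of a function `g` of the size over all particles of `X`. -/
def weight (g : ℕ+ → ℕ) (X : Config) : ℕ := X.sum fun i m => m * g i

theorem weight_add (g : ℕ+ → ℕ) (X Y : Config) : weight g (X + Y) = weight g X + weight g Y :=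
  Finsupp.sum_add_index' (by simp) (by intros; ring)

theorem weight_single (g : ℕ+ → ℕ) (i : ℕ+) (m : ℕ) :
    weight g (Finsupp.single i m) = m * g i :=
  Finsupp.sum_single_index (by simp)

theorem weight_one (X : Config) : weight (fun _ => 1) X = numParticles X := by
  simp [weight, numParticles]

theorem numParticles_eq_zero_iff (X : Config) : numParticles X = 0 ↔ X = 0 := by
  constructor
  · intro h
    ext i
    by_contra hi
    have : X i = 0 := Finset.sum_eq_zero_iff.1 h i (by simpa using hi)
    exact hi this
  · rintro rfl
    simp [numParticles]

theorem weight_mono {g g' : ℕ+ → ℕ} (X : Config) (h : ∀ i ∈ X.support, g i ≤ g' i) :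
    weight g X ≤ weight g' X :=
  Finset.sum_le_sum fun i hi => Nat.mul_le_mul_left _ (h i hi)

theorem weight_const_mul (a : ℕ) (X : Config) : weight (fun _ => a) X = numParticles X * a := by
  simp [weight, numParticles, Finsupp.sum, Finset.sum_mul]

/-- The total mass `∑ i, i * X i`. -/
def mass (X : Config) : ℕ := weight (fun i => i) X

/-! ### Merging -/

theorem minSize_mem_support {X : Config} (h : X ≠ 0) : minSize X ∈ X.support := by
  have hs : X.support.Nonempty := Finsupp.support_nonempty_iff.2 h
  rw [minSize, dif_pos hs]
  exact Finset.min'_mem _ _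

theorem minSize_le {X : Config} {i : ℕ+} (hi : i ∈ X.support) : minSize X ≤ i := by
  have hs : X.support.Nonempty := ⟨i, hi⟩
  rw [minSize, dif_pos hs]
  exact Finset.min'_le _ _ hi

/-- The particles with which a given minimal one can merge. -/
noncomputable def partners (X : Config) : Config := X - Finsupp.single (minSize X) 1

theorem partners_add_single {X : Config} (h : X ≠ 0) :
    partners X + Finsupp.single (minSize X) 1 = X := by
  refine tsub_add_cancel_of_le ?_
  rw [Finsupp.single_le_iff]
  exact Nat.one_le_iff_ne_zero.2 (Finsupp.mem_support_iff.1 (minSize_mem_support h))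

theorem partners_apply (X : Config) (j : ℕ+) : partners X j = numPartners X j := by
  rw [partners, numPartners, Finsupp.tsub_apply]
  split_ifs with h
  · simp [h]
  · rw [Finsupp.single_apply, if_neg (Ne.symm h), tsub_zero]

theorem weight_partners (g : ℕ+ → ℕ) {X : Config} (h : X ≠ 0) :
    weight g (partners X) + g (minSize X) = weight g X := by
  conv_rhs => rw [← partners_add_single h, weight_add, weight_single, one_mul]

theorem numParticles_partners (X : Config) : numParticles (partners X) = numParticles X - 1 := by
  rcases eq_or_ne X 0 with rfl | h
  · simp [partners, numParticles]
  · have := weight_partners (fun _ => 1) h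
    simp only [weight_one] at this
    omega

theorem minSize_le_of_mem_partners {X : Config} {j : ℕ+} (hj : partners X j ≠ 0) :
    minSize X ≤ j := by
  refine minSize_le (Finsupp.mem_support_iff.2 fun h => hj ?_)
  simp [partners, h]

theorem merge_add_single {X : Config} {j : ℕ+} (hj : partners X j ≠ 0) :
    merge X j + Finsupp.single j 1 = partners X + Finsupp.single (minSize X + j) 1 := by
  change partners X - Finsupp.single j 1 + Finsupp.single (minSize X + j) 1 + Finsupp.single j 1 = _
  rw [add_right_comm, tsub_add_cancel_of_le]
  rw [Finsupp.single_le_iff]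
  exact Nat.one_le_iff_ne_zero.2 hj

theorem weight_merge (g : ℕ+ → ℕ) {X : Config} (h : X ≠ 0) {j : ℕ+} (hj : partners X j ≠ 0) :
    weight g (merge X j) + g (minSize X) + g j = weight g X + g (minSize X + j) := by
  have h1 := congrArg (weight g) (merge_add_single hj)
  simp only [weight_add, weight_single, one_mul] at h1
  have h2 := weight_partners g h
  omega

theorem numParticles_merge {X : Config} (h : X ≠ 0) {j : ℕ+} (hj : partners X j ≠ 0) :
    numParticles (merge X j) + 1 = numParticles X := by
  have := weight_merge (fun _ => 1) h hj
  simp only [weight_one] at this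
  omega

theorem mass_merge {X : Config} (h : X ≠ 0) {j : ℕ+} (hj : partners X j ≠ 0) :
    mass (merge X j) = mass X := by
  have := weight_merge (fun i => i) h hj
  simp only [PNat.add_coe] at this
  unfold mass
  omega

theorem merge_ne_zero (X : Config) (j : ℕ+) : merge X j ≠ 0 := by
  intro h
  have := DFunLike.congr_fun h (minSize X + j)
  simp [merge] at this

theorem minSize_le_minSize_merge (X : Config) {j : ℕ+} (hj : partners X j ≠ 0) :
    minSize X ≤ minSize (merge X j) := by
  have hm := minSize_mem_support (merge_ne_zero X j)
  have h1 := DFunLike.congr_fun (merge_add_single hj) (minSize (merge X j))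
  rw [Finsupp.mem_support_iff] at hm
  simp only [Finsupp.add_apply] at h1
  by_cases hp : partners X (minSize (merge X j)) = 0
  · by_cases he : minSize X + j = minSize (merge X j)
    · rw [← he]
      exact (PNat.lt_add_right _ _).le
    · rw [hp, Finsupp.single_eq_of_ne (Ne.symm he)] at h1
      omega
  · exact minSize_le_of_mem_partners hp

theorem minSize_mul_numParticles_le_mass (X : Config) :
    (minSize X : ℕ) * numParticles X ≤ mass X := by
  rw [mul_comm, ← weight_const_mul]
  exact weight_mono X fun i hi => PNat.coe_le_coe _ _ |>.2 (minSize_le hi)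

/-! ### Rates for the kernel `φ i ∧ φ j` -/

/-- The kernel `φ i ∧ φ j`. -/
abbrev minKernel (φ : ℕ+ → ℝ≥0) (i j : ℕ+) : ℝ≥0 := min (φ i) (φ j)

theorem rate_minKernel {φ : ℕ+ → ℝ≥0} (hmono : Monotone φ) (X : Config) (j : ℕ+) :
    rate (minKernel φ) X j = φ (minSize X) * partners X j := by
  rw [rate, ← partners_apply]
  by_cases hj : partners X j = 0
  · simp [hj]
  · rw [minKernel, min_eq_left (hmono (minSize_le_of_mem_partners hj))]

theorem totalRate_minKernel {φ : ℕ+ → ℝ≥0} (hmono : Monotone φ) (X : Config) :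
    totalRate (minKernel φ) X = φ (minSize X) * ((numParticles X - 1 : ℕ) : ℝ≥0∞) := by
  have h : ∀ j, ((rate (minKernel φ) X j : ℝ≥0) : ℝ≥0∞) =
      φ (minSize X) * (partners X j : ℝ≥0∞) := fun j => by
    rw [rate_minKernel hmono]
    push_cast
    rfl
  rw [totalRate, tsum_congr h, ENNReal.tsum_mul_left, ← numParticles_partners,
    tsum_eq_sum (s := (partners X).support) (by simp), numParticles, Finsupp.sum, Nat.cast_sum]

theorem totalRate_minKernel_eq_zero_iff {φ : ℕ+ → ℝ≥0} (hpos : ∀ i, 0 < φ i)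
    (hmono : Monotone φ) (X : Config) :
    totalRate (minKernel φ) X = 0 ↔ numParticles X ≤ 1 := by
  rw [totalRate_minKernel hmono, mul_eq_zero]
  have : (φ (minSize X) : ℝ≥0∞) ≠ 0 := by exact_mod_cast (hpos _).ne'
  simp only [this, false_or, Nat.cast_eq_zero]
  omega

/-- The partner of the minimal particle is uniform among the others, whatever `φ` is. -/
theorem lintegral_jumpKernel_minKernel {φ : ℕ+ → ℝ≥0} (hpos : ∀ i, 0 < φ i) (hmono : Monotone φ)
    {X : Config} (hX : 2 ≤ numParticles X) (f : Config → ℝ≥0∞) :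
    ∫⁻ Y, f Y ∂(jumpKernel (minKernel φ) X) =
      ((numParticles X - 1 : ℕ) : ℝ≥0∞)⁻¹ *
        ∑ j ∈ (partners X).support, partners X j * f (merge X j) := by
  have h0 : totalRate (minKernel φ) X ≠ 0 := by
    rw [Ne, totalRate_minKernel_eq_zero_iff hpos hmono]
    omega
  have hφ : (φ (minSize X) : ℝ≥0∞) ≠ 0 := by exact_mod_cast (hpos _).ne'
  rw [lintegral_jumpKernel _ _ h0, tsum_eq_sum (s := (partners X).support), Finset.mul_sum]
  · refine Finset.sum_congr rfl fun j _ => ?_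
    rw [rate_minKernel hmono, totalRate_minKernel hmono,
      ENNReal.mul_inv (.inl hφ) (.inl ENNReal.coe_ne_top), ENNReal.coe_mul]
    calc f (merge X j) * (φ (minSize X) * ((partners X j : ℝ≥0) : ℝ≥0∞) *
          ((φ (minSize X) : ℝ≥0∞)⁻¹ * ((numParticles X - 1 : ℕ) : ℝ≥0∞)⁻¹))
        = (φ (minSize X) * (φ (minSize X) : ℝ≥0∞)⁻¹) * (((numParticles X - 1 : ℕ) : ℝ≥0∞)⁻¹ *
            (((partners X j : ℝ≥0) : ℝ≥0∞) * f (merge X j))) := by ring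
      _ = _ := by
        rw [ENNReal.mul_inv_cancel hφ ENNReal.coe_ne_top, one_mul]
        simp
  · intro j hj
    rw [rate_minKernel hmono, Finsupp.notMem_support_iff.1 hj]
    simp

/-- Before absorption, the state after `n` jumps has `n` particles less and the same mass. -/
theorem ae_chainLaw_minKernel {φ : ℕ+ → ℝ≥0} (hpos : ∀ i, 0 < φ i) (hmono : Monotone φ)
    {X₀ : Config} (hX₀ : X₀ ≠ 0) :
    ∀ᵐ y ∂(chainLaw (minKernel φ) X₀), ∀ n,
      numParticles (y n) = max 1 (numParticles X₀ - n) ∧ mass (y n) = mass X₀ := by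
  refine ae_chainLaw_of_jumpKernel _ _
    (fun n X => numParticles X = max 1 (numParticles X₀ - n) ∧ mass X = mass X₀) ?_ ?_
  · have := mt (numParticles_eq_zero_iff X₀).1 hX₀
    exact ⟨by omega, rfl⟩
  · rintro n X ⟨hn, hm⟩
    have hX : X ≠ 0 := fun h => by
      have := (numParticles_eq_zero_iff X).2 h
      omega
    by_cases h0 : totalRate (minKernel φ) X = 0
    · refine ae_jumpKernel_of_totalRate_eq_zero _ _ h0 ⟨?_, hm⟩
      have := (totalRate_minKernel_eq_zero_iff hpos hmono X).1 h0
      omega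
    · refine ae_jumpKernel _ _ h0 fun j hj => ?_
      have hj' : partners X j ≠ 0 := fun h => hj (by rw [rate_minKernel hmono, h]; simp)
      have h1 := numParticles_merge hX hj'
      have h2 := mt (totalRate_minKernel_eq_zero_iff hpos hmono X).2 h0
      exact ⟨by omega, (mass_merge hX hj').trans hm⟩

/-- The expected last time is the sum of the mean sojourn times in the states with more than one
particle. -/
theorem expectedLastTime_minKernel {φ : ℕ+ → ℝ≥0} (hpos : ∀ i, 0 < φ i) (hmono : Monotone φ)
    {X₀ : Config} (hX₀ : X₀ ≠ 0) :
    expectedLastTime (minKernel φ) X₀ = ∑ k ∈ Finset.range (numParticles X₀ - 1),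
      ∫⁻ y, (totalRate (minKernel φ) (y k))⁻¹ ∂(chainLaw (minKernel φ) X₀) := by
  rw [← lintegral_jumpTime, expectedLastTime]
  refine lintegral_congr_ae ?_
  filter_upwards [ae_clock_pos _ _,
    ae_law_of_ae_chainLaw _ _ (ae_chainLaw_minKernel hpos hmono hX₀)] with ω hc hω
  refine lastTime_eq_jumpTime _ _ _ hc (fun k hk => ?_) ?_ ?_
  · have := (hω k).1
    rw [Ne, totalRate_minKernel_eq_zero_iff hpos hmono]
    omega
  · have := (hω (numParticles X₀ - 1)).1
    rw [totalRate_minKernel_eq_zero_iff hpos hmono]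
    omega
  · have := (hω (numParticles X₀ - 1)).1
    omega

/-! ### The Lyapunov function -/

/-- The dyadic scale of the minimal size: the `k` with `2 ^ k ≤ ℓ < 2 ^ (k + 1)`. -/
def scale (X : Config) : ℕ := Nat.log 2 (minSize X)

/-- The number of particles of size less than `2 ^ (k + 1)`. -/
def smallCount (k : ℕ) (X : Config) : ℕ :=
  weight (fun i => if (i : ℕ) < 2 ^ (k + 1) then 1 else 0) X

theorem smallCount_le (k : ℕ) (X : Config) : smallCount k X ≤ numParticles X := by
  rw [← weight_one]
  exact weight_mono X fun i _ => by split_ifs <;> simp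

theorem two_pow_scale_le (X : Config) : 2 ^ scale X ≤ (minSize X : ℕ) :=
  Nat.pow_log_le_self 2 (minSize X).ne_zero

theorem minSize_lt_two_pow (X : Config) : (minSize X : ℕ) < 2 ^ (scale X + 1) :=
  Nat.lt_pow_succ_log_self one_lt_two _

theorem smallCount_merge {X : Config} (h : X ≠ 0) {j : ℕ+} (hj : partners X j ≠ 0) :
    smallCount (scale X) (merge X j) + 1 +
      (if (j : ℕ) < 2 ^ (scale X + 1) then 1 else 0) = smallCount (scale X) X := by
  have h1 := weight_merge (fun i => if (i : ℕ) < 2 ^ (scale X + 1) then 1 else 0) h hj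
  have h2 : ¬ ((minSize X + j : ℕ+) : ℕ) < 2 ^ (scale X + 1) := by
    have h3 := two_pow_scale_le X
    have h4 : (minSize X : ℕ) ≤ j := minSize_le_of_mem_partners hj
    rw [PNat.add_coe, pow_succ]
    omega
  simp only [if_pos (minSize_lt_two_pow X), if_neg h2, add_zero] at h1
  exact h1

/-- With `n` particles, `s` of which are small, the mean number of small particles after the next
jump is `(n - 2) * (s - 1) / (n - 1)`. -/
theorem sum_smallCount_merge {X : Config} (h : 2 ≤ numParticles X) :
    ∑ j ∈ (partners X).support, partners X j * smallCount (scale X) (merge X j) =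
      (numParticles X - 2) * (smallCount (scale X) X - 1) := by
  have hX : X ≠ 0 := fun h0 => by
    have := (numParticles_eq_zero_iff X).2 h0
    omega
  set S := ∑ j ∈ (partners X).support, partners X j * smallCount (scale X) (merge X j)
  have h1 : S + numParticles (partners X) +
      weight (fun i => if (i : ℕ) < 2 ^ (scale X + 1) then 1 else 0) (partners X) =
      numParticles (partners X) * smallCount (scale X) X := by
    rw [numParticles, weight, Finsupp.sum, Finsupp.sum, ← Finset.sum_add_distrib,
      ← Finset.sum_add_distrib, Finset.sum_mul]
    refine Finset.sum_congr rfl fun j hj => ?_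
    rw [← smallCount_merge hX (Finsupp.mem_support_iff.1 hj)]
    ring
  have h2 := weight_partners (fun i => if (i : ℕ) < 2 ^ (scale X + 1) then 1 else 0) hX
  rw [if_pos (minSize_lt_two_pow X)] at h2
  change _ = smallCount (scale X) X at h2
  rw [numParticles_partners] at h1
  obtain ⟨a, ha⟩ := Nat.exists_eq_add_of_le h
  rw [← h2, ha] at h1
  rw [← h2, ha, Nat.add_sub_cancel, Nat.add_sub_cancel_left]
  rw [show 2 + a - 1 = a + 1 by omega] at h1
  linarith

/-- The proportion of small particles, with denominator `n - 1` in place of `n`: with this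
normalization its mean decreases by exactly `1 / (n - 1)` at each jump from `n ≥ 3` particles. For
a single particle the division by zero makes it `0`, the value wanted at absorption. -/
noncomputable def smallRatio (k : ℕ) (X : Config) : ℝ≥0 :=
  smallCount k X / (numParticles X - 1 : ℕ)

theorem smallRatio_le_two (k : ℕ) (X : Config) : smallRatio k X ≤ 2 := by
  unfold smallRatio
  rcases le_or_gt (numParticles X) 1 with h | h
  · simp [Nat.sub_eq_zero_of_le h]
  · refine div_le_of_le_mul₀ zero_le zero_le ?_
    have := smallCount_le k X
    exact_mod_cast show smallCount k X ≤ 2 * (numParticles X - 1) by omega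

/-- The quantity `1 / φ (2 ^ k)`, a bound for `1 / φ ℓ` at scale `k`. -/
noncomputable def invDyadic (φ : ℕ+ → ℝ≥0) (k : ℕ) : ℝ≥0 := (φ (2 ^ k))⁻¹

theorem inv_le_invDyadic_scale {φ : ℕ+ → ℝ≥0} (hpos : ∀ i, 0 < φ i) (hmono : Monotone φ)
    (X : Config) : (φ (minSize X))⁻¹ ≤ invDyadic φ (scale X) := by
  refine inv_anti₀ (hpos _) (hmono ?_)
  rw [← PNat.coe_le_coe, PNat.pow_coe]
  exact two_pow_scale_le X

/-- The bound `2 * ∑_{j > k} 1 / φ (2 ^ j)` for the mean time spent at scales above `k`. -/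
noncomputable def dyadicTail (φ : ℕ+ → ℝ≥0) (k : ℕ) : ℝ≥0∞ :=
  ∑' j : ℕ, if k < j then 2 * (invDyadic φ j : ℝ≥0∞) else 0

theorem add_dyadicTail_le (φ : ℕ+ → ℝ≥0) {k l : ℕ} (h : k < l) :
    2 * (invDyadic φ l : ℝ≥0∞) + dyadicTail φ l ≤ dyadicTail φ k := by
  rw [dyadicTail, dyadicTail, ← tsum_ite_eq l (fun _ => 2 * (invDyadic φ l : ℝ≥0∞)),
    ← ENNReal.tsum_add]
  refine ENNReal.tsum_le_tsum fun j => ?_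
  rcases lt_trichotomy j l with hj | rfl | hj
  · simp [hj.ne, hj.not_gt]
  · simp [h]
  · simp [hj.ne', hj, h.trans hj]

/-- A bound for the mean time to absorption: the proportion of small particles accounts for the
current scale, and each later scale `j` for at most `2 / φ (2 ^ j)`. -/
noncomputable def potential (φ : ℕ+ → ℝ≥0) (X : Config) : ℝ≥0∞ :=
  invDyadic φ (scale X) * smallRatio (scale X) X + dyadicTail φ (scale X)

theorem potential_le (φ : ℕ+ → ℝ≥0) (X : Config) :
    potential φ X ≤ 2 * (invDyadic φ (scale X) : ℝ≥0∞) + dyadicTail φ (scale X) := by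
  rw [potential, mul_comm]
  gcongr
  exact_mod_cast smallRatio_le_two _ _

theorem potential_le_tsum (φ : ℕ+ → ℝ≥0) (X : Config) :
    potential φ X ≤ 2 * ∑' k, (invDyadic φ k : ℝ≥0∞) := by
  refine (potential_le φ X).trans ?_
  rw [dyadicTail, ← ENNReal.tsum_mul_left,
    ← tsum_ite_eq (scale X) (fun _ => 2 * (invDyadic φ (scale X) : ℝ≥0∞)), ← ENNReal.tsum_add]
  refine ENNReal.tsum_le_tsum fun j => ?_
  rcases lt_trichotomy j (scale X) with hj | rfl | hj
  · simp [hj.ne, hj.not_gt]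
  · simp
  · simp [hj.ne', hj]

/-- The potential of the next state, when the scale may have changed, is at most what it would be
at the old scale. -/
theorem potential_merge_le (φ : ℕ+ → ℝ≥0) (X : Config) {j : ℕ+} (hj : partners X j ≠ 0) :
    potential φ (merge X j) ≤
      invDyadic φ (scale X) * smallRatio (scale X) (merge X j) + dyadicTail φ (scale X) := by
  have h : scale X ≤ scale (merge X j) := Nat.log_mono_right (minSize_le_minSize_merge X hj)
  rcases h.eq_or_lt with he | hlt
  · rw [potential, he]
  -- A move to a higher scale `l` is paid for by the term `2 / φ (2 ^ l)` of the tail.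
  · exact (potential_le φ _).trans ((add_dyadicTail_le φ hlt).trans le_add_self)

theorem sum_smallRatio_merge_add_one_le {X : Config} (h : 2 ≤ numParticles X) :
    ∑ j ∈ (partners X).support, partners X j * smallRatio (scale X) (merge X j) + 1 ≤
      smallCount (scale X) X := by
  have hX : X ≠ 0 := fun h0 => by
    have := (numParticles_eq_zero_iff X).2 h0
    omega
  have h1 : ∑ j ∈ (partners X).support, partners X j * smallRatio (scale X) (merge X j) =
      ((numParticles X - 2 : ℕ) : ℝ≥0) * (smallCount (scale X) X - 1 : ℕ) /
        (numParticles X - 2 : ℕ) := by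
    rw [← Nat.cast_mul, ← sum_smallCount_merge h, Nat.cast_sum, Finset.sum_div]
    refine Finset.sum_congr rfl fun j hj => ?_
    have := numParticles_merge hX (Finsupp.mem_support_iff.1 hj)
    rw [smallRatio, show numParticles (merge X j) - 1 = numParticles X - 2 by omega,
      Nat.cast_mul, mul_div_assoc]
  have h2 : 1 ≤ smallCount (scale X) X := by
    have := weight_partners (fun i => if (i : ℕ) < 2 ^ (scale X + 1) then 1 else 0) hX
    rw [if_pos (minSize_lt_two_pow X)] at this
    change _ = smallCount (scale X) X at this
    omega
  have h3 : ((smallCount (scale X) X - 1 : ℕ) : ℝ≥0) + 1 = smallCount (scale X) X := by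
    exact_mod_cast Nat.sub_add_cancel h2
  rw [h1, ← h3]
  gcongr
  rw [mul_comm]
  exact div_le_of_le_mul₀ zero_le zero_le le_rfl

/-- The drift inequality: in each state with more than one particle the potential decreases in the
mean by at least the mean sojourn time. -/
theorem lintegral_potential_add_le {φ : ℕ+ → ℝ≥0} (hpos : ∀ i, 0 < φ i) (hmono : Monotone φ)
    {X : Config} (h : 2 ≤ numParticles X) :
    ∫⁻ Y, potential φ Y ∂(jumpKernel (minKernel φ) X) + (totalRate (minKernel φ) X)⁻¹ ≤
      potential φ X := by
  have hφ : (φ (minSize X) : ℝ≥0∞) ≠ 0 := by exact_mod_cast (hpos _).ne'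
  have hn0 : ((numParticles X - 1 : ℕ) : ℝ≥0∞) ≠ 0 := by
    rw [Nat.cast_ne_zero]
    omega
  have hnt : ((numParticles X - 1 : ℕ) : ℝ≥0∞) ≠ ∞ := ENNReal.natCast_ne_top _
  rw [lintegral_jumpKernel_minKernel hpos hmono h, totalRate_minKernel hmono,
    ENNReal.mul_inv (.inl hφ) (.inl ENNReal.coe_ne_top), ← ENNReal.coe_inv (hpos _).ne']
  set c := invDyadic φ (scale X)
  have hc : (((φ (minSize X))⁻¹ : ℝ≥0) : ℝ≥0∞) ≤ c :=
    ENNReal.coe_le_coe.2 (inv_le_invDyadic_scale hpos hmono X)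
  have h1 : ∑ j ∈ (partners X).support, (partners X j : ℝ≥0∞) * potential φ (merge X j) ≤
      c * ((∑ j ∈ (partners X).support, partners X j * smallRatio (scale X) (merge X j) : ℝ≥0) :
        ℝ≥0∞) + ((numParticles X - 1 : ℕ) : ℝ≥0∞) * dyadicTail φ (scale X) := by
    rw [← numParticles_partners, numParticles, Finsupp.sum, Nat.cast_sum, Finset.sum_mul,
      ENNReal.ofNNReal_finsetSum, Finset.mul_sum, ← Finset.sum_add_distrib]
    refine Finset.sum_le_sum fun j hj => ?_
    refine (mul_le_mul_right (potential_merge_le φ X (Finsupp.mem_support_iff.1 hj)) _).trans_eq ?_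
    push_cast
    ring
  calc _ ≤ ((numParticles X - 1 : ℕ) : ℝ≥0∞)⁻¹ *
        (c * ((∑ j ∈ (partners X).support, partners X j * smallRatio (scale X) (merge X j) : ℝ≥0) :
          ℝ≥0∞) + ((numParticles X - 1 : ℕ) : ℝ≥0∞) * dyadicTail φ (scale X)) +
        c * ((numParticles X - 1 : ℕ) : ℝ≥0∞)⁻¹ := by gcongr
    _ = ((numParticles X - 1 : ℕ) : ℝ≥0∞)⁻¹ *
        (c * ((∑ j ∈ (partners X).support, partners X j * smallRatio (scale X) (merge X j) + 1 :
          ℝ≥0) : ℝ≥0∞)) + (((numParticles X - 1 : ℕ) : ℝ≥0∞)⁻¹ * ((numParticles X - 1 : ℕ) : ℝ≥0∞)) *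
          dyadicTail φ (scale X) := by
      rw [ENNReal.coe_add, ENNReal.coe_one]
      ring
    _ ≤ ((numParticles X - 1 : ℕ) : ℝ≥0∞)⁻¹ * (c * ((smallCount (scale X) X : ℝ≥0) : ℝ≥0∞)) +
          dyadicTail φ (scale X) := by
      rw [ENNReal.inv_mul_cancel hn0 hnt, one_mul]
      gcongr
      exact sum_smallRatio_merge_add_one_le h
    _ = potential φ X := by
      rw [potential, smallRatio, ENNReal.coe_div (by exact_mod_cast hn0), div_eq_mul_inv]
      push_cast
      ring

/-- Summing the drift inequality along the jump chain bounds the mean absorption time. -/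
theorem expectedLastTime_le {φ : ℕ+ → ℝ≥0} (hpos : ∀ i, 0 < φ i) (hmono : Monotone φ)
    {X₀ : Config} (hX₀ : X₀ ≠ 0) :
    expectedLastTime (minKernel φ) X₀ ≤ 2 * ∑' k, (invDyadic φ k : ℝ≥0∞) := by
  rw [expectedLastTime_minKernel hpos hmono hX₀]
  refine le_trans ?_ (potential_le_tsum φ X₀)
  have hp : ∀ n ≤ numParticles X₀ - 1,
      ∫⁻ y, potential φ (y n) ∂(chainLaw (minKernel φ) X₀) + ∑ k ∈ Finset.range n,
        ∫⁻ y, (totalRate (minKernel φ) (y k))⁻¹ ∂(chainLaw (minKernel φ) X₀) ≤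
      potential φ X₀ := by
    intro n
    induction n with
    | zero => intro _; simp [lintegral_chainLaw_zero]
    | succ n ih =>
      intro hn
      refine le_trans ?_ (ih (by omega))
      have hr : Measurable fun X => (totalRate (minKernel φ) X)⁻¹ := measurable_of_countable _
      have hr' : Measurable fun y : ℕ → Config => (totalRate (minKernel φ) (y n))⁻¹ :=
        hr.comp (measurable_pi_apply n)
      rw [lintegral_chainLaw_succ, Finset.sum_range_succ, add_comm (Finset.sum _ _), ← add_assoc,
        ← lintegral_add_right _ hr']
      gcongr ?_ + _
      refine lintegral_mono_ae ?_
      filter_upwards [ae_chainLaw_minKernel hpos hmono hX₀] with y hy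
      have := (hy n).1
      exact lintegral_potential_add_le hpos hmono (by omega)
  exact le_add_self.trans (hp _ le_rfl)

/-! ### Cauchy condensation -/

theorem summable_iff_tsum_invDyadic_ne_top {φ : ℕ+ → ℝ≥0} (hpos : ∀ i, 0 < φ i)
    (hmono : Monotone φ) :
    Summable (fun i : ℕ+ => 1 / ((i : ℝ) * (φ i : ℝ))) ↔
      ∑' k, (invDyadic φ k : ℝ≥0∞) ≠ ∞ := by
  rw [ENNReal.tsum_coe_ne_top_iff_summable]
  set f : ℕ → ℝ≥0 := fun n => 1 / ((n : ℝ≥0) * φ n.toPNat') with hf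
  have h1 : Summable (fun i : ℕ+ => 1 / ((i : ℝ) * (φ i : ℝ))) ↔ Summable f := by
    rw [← NNReal.summable_coe, ← summable_pnat_iff_summable_nat (f := fun n => (f n : ℝ))]
    simp [hf]
  have h2 : (fun k : ℕ => (2 : ℝ≥0) ^ k * f (2 ^ k)) = invDyadic φ := by
    ext1 k
    have : (2 ^ k : ℕ).toPNat' = 2 ^ k := by
      rw [← PNat.coe_inj, Nat.toPNat'_coe, if_pos (by positivity), PNat.pow_coe]
      rfl
    simp only [hf, this, invDyadic]
    push_cast
    have := (hpos (2 ^ k)).ne'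
    field_simp
  rw [h1, ← NNReal.summable_condensed_iff, h2]
  intro m n hm hmn
  simp only [hf]
  have : φ m.toPNat' ≤ φ n.toPNat' := hmono (by
    rw [← PNat.coe_le_coe, Nat.toPNat'_coe, Nat.toPNat'_coe, if_pos hm, if_pos (hm.trans_le hmn)]
    exact hmn)
  have := hpos m.toPNat'
  have : (0 : ℝ≥0) < m := by exact_mod_cast hm
  gcongr

/-! ### Starting from particles of size one -/

/-- The configuration of `2 ^ m` particles of size `1`. -/
noncomputable def ones (m : ℕ) : Config := Finsupp.single 1 (2 ^ m)

theorem numParticles_ones (m : ℕ) : numParticles (ones m) = 2 ^ m := by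
  rw [← weight_one, ones, weight_single, mul_one]

theorem mass_ones (m : ℕ) : mass (ones m) = 2 ^ m := by
  rw [mass, ones, weight_single, PNat.one_coe, mul_one]

theorem ones_ne_zero (m : ℕ) : ones m ≠ 0 := by simp [ones]

/-- With more than `2 ^ p` particles of total mass `2 ^ m` the minimal size is at most
`2 ^ (m - p)`. -/
theorem inv_totalRate_ge {φ : ℕ+ → ℝ≥0} (hpos : ∀ i, 0 < φ i) (hmono : Monotone φ) {m p i : ℕ}
    (hp : p < m) (hi : 2 ^ p ≤ i) (hi' : i < 2 ^ (p + 1)) {X : Config}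
    (hn : numParticles X = i + 1) (hm : mass X = 2 ^ m) :
    (invDyadic φ (m - p) : ℝ≥0∞) * (2 ^ (p + 1))⁻¹ ≤ (totalRate (minKernel φ) X)⁻¹ := by
  have hφ : (φ (minSize X) : ℝ≥0∞) ≠ 0 := by exact_mod_cast (hpos _).ne'
  have hl : minSize X ≤ 2 ^ (m - p) := by
    rw [← PNat.coe_le_coe, PNat.pow_coe]
    have h1 := minSize_mul_numParticles_le_mass X
    rw [hn, hm] at h1
    have h2 : 2 ^ m = 2 ^ (m - p) * 2 ^ p := by rw [← pow_add, Nat.sub_add_cancel hp.le]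
    refine Nat.le_of_mul_le_mul_right (c := 2 ^ p) ?_ (by positivity)
    calc (minSize X : ℕ) * 2 ^ p ≤ minSize X * (i + 1) := Nat.mul_le_mul_left _ (by omega)
      _ ≤ 2 ^ m := h1
      _ = _ := h2
  rw [totalRate_minKernel hmono, ENNReal.mul_inv (.inl hφ) (.inl ENNReal.coe_ne_top), hn,
    Nat.add_sub_cancel, invDyadic, ENNReal.coe_inv (hpos _).ne']
  gcongr
  · exact hmono hl
  · exact_mod_cast hi'.le

/-- Started from `2 ^ m` particles of size `1`, while the number of particles drops from
`2 ^ (p + 1)` to `2 ^ p`, the process spends a mean time of at least `1 / (2 * φ (2 ^ (m - p)))`,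
for each `p < m`. -/
theorem sum_invDyadic_le {φ : ℕ+ → ℝ≥0} (hpos : ∀ i, 0 < φ i) (hmono : Monotone φ) (m : ℕ) :
    ∑ p ∈ Finset.range m, (invDyadic φ (p + 1) : ℝ≥0∞) ≤
      2 * expectedLastTime (minKernel φ) (ones m) := by
  rw [expectedLastTime_minKernel hpos hmono (ones_ne_zero m), numParticles_ones]
  set g : ℕ → ℝ≥0∞ := fun k =>
    ∫⁻ y, (totalRate (minKernel φ) (y k))⁻¹ ∂(chainLaw (minKernel φ) (ones m))
  -- After `2 ^ m - 1 - i` jumps there are `i + 1` particles.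
  have hg : ∀ p < m, ∀ i ∈ Finset.Ico (2 ^ p) (2 ^ (p + 1)),
      (invDyadic φ (m - p) : ℝ≥0∞) * (2 ^ (p + 1))⁻¹ ≤ g (2 ^ m - 1 - i) := by
    intro p hp i hi
    rw [Finset.mem_Ico] at hi
    have h2 : 2 ^ (p + 1) ≤ 2 ^ m := Nat.pow_le_pow_right two_pos hp
    have : IsProbabilityMeasure (chainLaw (minKernel φ) (ones m)) := by
      unfold chainLaw
      infer_instance
    calc (invDyadic φ (m - p) : ℝ≥0∞) * (2 ^ (p + 1))⁻¹
        = ∫⁻ _, (invDyadic φ (m - p) : ℝ≥0∞) * (2 ^ (p + 1))⁻¹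
            ∂(chainLaw (minKernel φ) (ones m)) := by simp
      _ ≤ _ := by
        refine lintegral_mono_ae ?_
        filter_upwards [ae_chainLaw_minKernel hpos hmono (ones_ne_zero m)] with y hy
        obtain ⟨h3, h4⟩ := hy (2 ^ m - 1 - i)
        rw [numParticles_ones] at h3
        rw [mass_ones] at h4
        have := Nat.one_le_two_pow (n := p)
        exact inv_totalRate_ge hpos hmono hp hi.1 hi.2 (by omega) h4
  have hblock : ∀ p < m, (invDyadic φ (m - p) : ℝ≥0∞) ≤
      2 * ∑ i ∈ Finset.Ico (2 ^ p) (2 ^ (p + 1)), g (2 ^ m - 1 - i) := by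
    intro p hp
    calc (invDyadic φ (m - p) : ℝ≥0∞)
        = 2 * ∑ i ∈ Finset.Ico (2 ^ p) (2 ^ (p + 1)),
            (invDyadic φ (m - p) : ℝ≥0∞) * (2 ^ (p + 1))⁻¹ := by
          rw [Finset.sum_const, Nat.card_Ico, nsmul_eq_mul,
            show 2 ^ (p + 1) - 2 ^ p = 2 ^ p by rw [pow_succ]; omega]
          have : (2 : ℝ≥0∞) ^ (p + 1) * (2 ^ (p + 1))⁻¹ = 1 :=
            ENNReal.mul_inv_cancel (by simp) (by simp)
          push_cast
          calc _ = (2 : ℝ≥0∞) ^ (p + 1) * (2 ^ (p + 1))⁻¹ * invDyadic φ (m - p) := by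
                rw [this, one_mul]
            _ = _ := by ring
      _ ≤ _ := by gcongr with i hi; exact hg p hp i hi
  have hsum : ∀ q ≤ m, ∑ p ∈ Finset.range q, (invDyadic φ (m - p) : ℝ≥0∞) ≤
      2 * ∑ i ∈ Finset.Ico 1 (2 ^ q), g (2 ^ m - 1 - i) := by
    intro q
    induction q with
    | zero => simp
    | succ q ih =>
      intro hq
      rw [Finset.sum_range_succ, ← Finset.sum_Ico_consecutive _ Nat.one_le_two_pow
        (Nat.pow_le_pow_right two_pos q.le_succ), mul_add]
      exact add_le_add (ih (by omega)) (hblock q hq)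
  calc ∑ p ∈ Finset.range m, (invDyadic φ (p + 1) : ℝ≥0∞)
      = ∑ p ∈ Finset.range m, (invDyadic φ (m - p) : ℝ≥0∞) := by
        rw [← Finset.sum_range_reflect]
        refine Finset.sum_congr rfl fun p hp => ?_
        rw [Finset.mem_range] at hp
        rw [show m - 1 - p + 1 = m - p by omega]
    _ ≤ 2 * ∑ i ∈ Finset.Ico 1 (2 ^ m), g (2 ^ m - 1 - i) := hsum m le_rfl
    _ = 2 * ∑ k ∈ Finset.range (2 ^ m - 1), g k := by
        rw [Finset.sum_Ico_eq_sum_range, ← Finset.sum_range_reflect g]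
        congr 1
        refine Finset.sum_congr rfl fun k _ => ?_
        congr 1
        omega

end MinDriven

theorem theorem1p5 (φ : ℕ+ → ℝ≥0) (hpos : ∀ i, 0 < φ i) (hmono : Monotone φ) :
    sSup (MinDriven.expectedLastTime (fun i j => min (φ i) (φ j)) '' {X₀ | X₀ ≠ 0}) < ∞ ↔
      Summable (fun i : ℕ+ => 1 / ((i : ℝ) * (φ i : ℝ))) := by
  rw [MinDriven.summable_iff_tsum_invDyadic_ne_top hpos hmono]
  constructor
  · intro h
    set s := sSup (MinDriven.expectedLastTime (fun i j => min (φ i) (φ j)) '' {X₀ | X₀ ≠ 0})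
    have hs : ∑' k, (MinDriven.invDyadic φ (k + 1) : ℝ≥0∞) ≤ 2 * s := by
      rw [ENNReal.tsum_eq_iSup_nat]
      refine iSup_le fun m => (MinDriven.sum_invDyadic_le hpos hmono m).trans ?_
      gcongr
      exact le_sSup ⟨MinDriven.ones m, MinDriven.ones_ne_zero m, rfl⟩
    rw [tsum_eq_zero_add' ENNReal.summable]
    exact ENNReal.add_ne_top.2 ⟨ENNReal.coe_ne_top,
      ne_top_of_le_ne_top (ENNReal.mul_ne_top ENNReal.ofNat_ne_top h.ne) hs⟩
  · intro h
    refine lt_of_le_of_lt (sSup_le ?_) (ENNReal.mul_lt_top (ENNReal.ofNat_lt_top (n := 2)) h.lt_top)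
    rintro _ ⟨X₀, hX₀, rfl⟩
    exact MinDriven.expectedLastTime_le hpos hmono hX₀
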